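/- Let $C,A_1,\dots,A_m\in\mathbb S^n$ be real symmetric matrices and $b\in\mathbb R^m$, let $\langle\cdot,\cdot\rangle$ be the trace inner product, $\|\cdot\|$ the Frobenius norm and $\operatorname{dist}(X,S)=\inf_{Y\in S}\|X-Y\|$. Consider the primal semidefinite program $$\min_X\ \langle C,X\rangle\quad\text{s.t. } \langle A_i,X\rangle=b_i\ (i=1,\dots,m),\ X\succeq 0,$$ and its dual $$\max_{y,Z}\ b^{\mathsf T}y\quad\text{s.t. } Z+\sum_{i=1}^m y_iA_i=C,\ Z\succeq 0,$$ with sets of optimal solutions $\mathcal P^\star$ and $\mathcal D^\star$. Assume that $A_1,\dots,A_m$ are linearly independent and that both programs are strictly feasible (there are a feasible $X\succ0$ and a feasible $(y,Z)$ with $Z\succ 0$). Let $\rho>2\max_{(y,Z)\in\mathcal D^\star}\operatorname{tr}(Z)+1$ and, for $X\in\mathbb S^n$, $$F(X)=\langle C,X\rangle+\rho\max\{\lambda_{\max}(-X),0\}.$$ Then $\mathcal P^\star\neq\emptyset$. Let $F^\star=F(X^\star)$ for $X^\star\in\mathcal P^\star$ (the value does not depend on the choice of $X^\star$). For $\epsilon>0$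 let $$\mathcal P_\epsilon=\{X\in\mathbb S^n:\ \langle A_i,X\rangle=b_i\ (i=1,\dots,m),\ F(X)\le F^\star+\epsilon\}.$$ For every $\epsilon>0$ there exist constants $\zeta\ge1$ and $\mu>0$ such that $$F(X)-F^\star\ \ge\ \mu\cdot\operatorname{dist}^{\zeta}(X,\mathcal P^\star)\qquad\text{for all }X\in\mathcal P_\epsilon .$$ If moreover strict complementarity holds, i.e. there are $X^\star\in\mathcal P^\star$ and $(y^\star,Z^\star)\in\mathcal D^\star$ with $\operatorname{rank}X^\star+\operatorname{rank}Z^\star=n$, then for every $\epsilon>0$ one can take $\zeta=2$: there is $\mu>0$ with $F(X)-F^\star\ge\mu\cdot\operatorname{dist}^2(X,\mathcal P^\star)$ for all $X\in\mathcal P_\epsilon$. -/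

import Mathlib

open Matrix

/-- The trace inner product `⟨X, Y⟩ = tr(Xᵀ Y)` on real `n × n` matrices. -/
noncomputable def traceInner {n : ℕ} (X Y : Matrix (Fin n) (Fin n) ℝ) : ℝ :=
  (Xᵀ * Y).trace

/-- The Frobenius norm `‖X‖ = √⟨X, X⟩`. -/
noncomputable def frobNorm {n : ℕ} (X : Matrix (Fin n) (Fin n) ℝ) : ℝ :=
  Real.sqrt (traceInner X X)

/-- `dist(X, S) = inf_{Y ∈ S} ‖Y - X‖` in the Frobenius norm. -/
noncomputable def frobDist {n : ℕ} (X : Matrix (Fin n) (Fin n) ℝ)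
    (S : Set (Matrix (Fin n) (Fin n) ℝ)) : ℝ :=
  sInf ((fun Y => frobNorm (Y - X)) '' S)

/-- The largest eigenvalue of a real symmetric matrix (the spectrum of a real symmetric matrix is
the finite set of its eigenvalues; for `n = 0` the value is `0`). -/
noncomputable def lambdaMax {n : ℕ} (X : Matrix (Fin n) (Fin n) ℝ) : ℝ :=
  sSup (spectrum ℝ X)

/-- Data `C, A₁, …, A_m ∈ 𝕊ⁿ`, `b ∈ ℝᵐ` of a primal-dual pair of standard-form SDPs.
For real matrices `IsHermitian` means symmetric. -/
structure SDPData (n m : ℕ) where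
  C : Matrix (Fin n) (Fin n) ℝ
  A : Fin m → Matrix (Fin n) (Fin n) ℝ
  b : Fin m → ℝ
  C_symm : C.IsHermitian
  A_symm : ∀ i, (A i).IsHermitian

namespace SDPData

variable {n m : ℕ} (P : SDPData n m)

/-- The affine set `{X ∈ 𝕊ⁿ | ⟨A_i, X⟩ = b_i, i = 1, …, m}`. -/
def affineSet : Set (Matrix (Fin n) (Fin n) ℝ) :=
  {X | X.IsHermitian ∧ ∀ i, traceInner (P.A i) X = P.b i}

/-- Feasible set of the primal SDP. -/
def primalFeasible : Set (Matrix (Fin n) (Fin n) ℝ) :=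
  {X | X ∈ P.affineSet ∧ X.PosSemidef}

/-- Feasible set of the dual SDP. -/
def dualFeasible : Set ((Fin m → ℝ) × Matrix (Fin n) (Fin n) ℝ) :=
  {p | p.2 + ∑ i, p.1 i • P.A i = P.C ∧ p.2.PosSemidef}

/-- The set of minimizers of `⟨C, X⟩` over the primal feasible set. -/
def primalOptimal : Set (Matrix (Fin n) (Fin n) ℝ) :=
  {X | X ∈ P.primalFeasible ∧ IsMinOn (fun Y => traceInner P.C Y) P.primalFeasible X}

/-- The set of maximizers of `bᵀ y` over the dual feasible set. -/
def dualOptimal : Set ((Fin m → ℝ) × Matrix (Fin n) (Fin n) ℝ) :=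
  {p | p ∈ P.dualFeasible ∧ IsMaxOn (fun q => P.b ⬝ᵥ q.1) P.dualFeasible p}

/-- Slater's condition: the primal and the dual SDP are both strictly feasible. -/
def Slater : Prop :=
  (∃ X ∈ P.affineSet, X.PosDef) ∧
    ∃ (y : Fin m → ℝ) (Z : Matrix (Fin n) (Fin n) ℝ), Z + ∑ i, y i • P.A i = P.C ∧ Z.PosDef

/-- Some primal-dual optimal pair satisfies `rank X + rank Z = n`. -/
def StrictComplementarity : Prop :=
  ∃ X ∈ P.primalOptimal, ∃ p ∈ P.dualOptimal, X.rank + p.2.rank = n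

/-- The largest trace of `Z` over the dual optimal solutions `(y, Z)`. -/
noncomputable def maxDualTrace : ℝ :=
  sSup ((fun p => p.2.trace) '' P.dualOptimal)

/-- The penalized primal objective `F(X) = ⟨C, X⟩ + ρ max{λ_max(-X), 0}`. -/
noncomputable def penalized (ρ : ℝ) (X : Matrix (Fin n) (Fin n) ℝ) : ℝ :=
  traceInner P.C X + ρ * max (lambdaMax (-X)) 0

end SDPData

/-!
Write `F⋆` for the optimal value and fix a dual optimal slack `Z`. Slater's condition gives primal
attainment (`primalOptimal_nonempty`, by compactness of sublevel sets) and dual attainment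
(`exists_dualFeasible_value_eq`, by separation), so on the affine set `⟨C, X⟩ - F⋆ = ⟨Z, X⟩`, and
the primal optimal set is cut out of the positive semidefinite cone by the affine equations and
`⟨Z, X⟩ = 0`. Since `ρ ≥ tr Z + 1`, the gap `δ = F(X) - F⋆` satisfies `X ⪰ -δ` and
`|⟨Z, X⟩| ≤ (1 + tr Z) δ`. Strict dual feasibility makes these `X` bounded. Hence the growth of `F`
follows from a Hölder error bound for an affine space and the positive semidefinite cone
(`exists_penalized_growth`).

That error bound (`HolderErrorBound`) is Sturm's, proved by facial reduction. Faces of the cone are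
described without coordinates by an orthogonal projection `P`: the face consists of the positive
semidefinite `X` with `P X P = X`. If the affine space meets the relative interior of the current
face, the bound is linear (`holderErrorBound_one_of_slater`). Otherwise separation yields a nonzero
positive semidefinite `W` in the span of the face that is orthogonal to the affine space
(`slater_or_exists_exposing`). A bounded `X ⪰ -δ` orthogonal to `W` is within `O(√δ)` of its
compression to the kernel of `W` (`exists_norm_sub_compression_sq_le`), so an error bound on that
smaller face with exponent `1 / k` gives one on the larger face with exponent `1 / (2 k)`
(`HolderErrorBound.of_face`). The rank of `P` drops at each step, so this ends.

Under strict complementarity the step with `W = Z` already reaches a face whose relative interior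
contains an optimal solution, so a single square root is lost and the exponent is `2`.
-/

section FrobeniusNorm

attribute [local instance] Matrix.frobeniusNormedAddCommGroup Matrix.frobeniusNormedSpace

/-! ### Trace, Frobenius norm and positive semidefinite matrices -/

section Basics

variable {ι : Type*} [Fintype ι]

theorem frobenius_norm_sq_eq_trace {κ : Type*} [Fintype κ] (A : Matrix ι κ ℝ) :
    ‖A‖ ^ 2 = (Aᵀ * A).trace := by
  rw [Matrix.frobenius_norm_def, ← Real.sqrt_eq_rpow, Real.sq_sqrt (by positivity)]
  simp only [Matrix.trace, Matrix.diag, Matrix.mul_apply, Matrix.transpose_apply]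
  rw [Finset.sum_comm]
  simp [sq]

theorem exists_eq_transpose_mul_self {X : Matrix ι ι ℝ} (hX : X.PosSemidef) :
    ∃ B : Matrix ι ι ℝ, X = Bᵀ * B := by
  classical
  open scoped MatrixOrder in
  obtain ⟨B, hB⟩ := CStarAlgebra.nonneg_iff_eq_star_mul_self.mp hX.nonneg
  exact ⟨B, by rw [hB, Matrix.star_eq_conjTranspose, Matrix.conjTranspose_eq_transpose_of_trivial]⟩

theorem posSemidef_conj {X : Matrix ι ι ℝ} (hX : X.PosSemidef) {P : Matrix ι ι ℝ} (hP : Pᵀ = P) :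
    (P * X * P).PosSemidef := by
  have := hX.conjTranspose_mul_mul_same P
  rwa [Matrix.conjTranspose_eq_transpose_of_trivial, hP] at this

theorem trace_mul_nonneg_of_posSemidef {X Y : Matrix ι ι ℝ} (hX : X.PosSemidef)
    (hY : Y.PosSemidef) : 0 ≤ (X * Y).trace := by
  obtain ⟨B, rfl⟩ := exists_eq_transpose_mul_self hX
  have := hY.mul_mul_conjTranspose_same B
  rw [Matrix.conjTranspose_eq_transpose_of_trivial] at this
  rw [Matrix.mul_assoc, Matrix.trace_mul_comm]
  exact this.trace_nonneg

theorem norm_le_trace_of_posSemidef {X : Matrix ι ι ℝ} (hX : X.PosSemidef) : ‖X‖ ≤ X.trace := by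
  obtain ⟨B, rfl⟩ := exists_eq_transpose_mul_self hX
  rw [← frobenius_norm_sq_eq_trace, sq]
  simpa only [Matrix.frobenius_norm_transpose] using Matrix.frobenius_norm_mul Bᵀ B

theorem abs_dotProduct_mulVec_le (E : Matrix ι ι ℝ) (v : ι → ℝ) :
    |v ⬝ᵥ E *ᵥ v| ≤ ‖E‖ * (v ⬝ᵥ v) := by
  have h0 : 0 ≤ v ⬝ᵥ v := by simpa using dotProduct_star_self_nonneg v
  have h1 : v ⬝ᵥ E *ᵥ v = ∑ p : ι × ι, E p.1 p.2 * (v p.1 * v p.2) := by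
    simp only [dotProduct, mulVec, Finset.mul_sum, Fintype.sum_prod_type]
    exact Finset.sum_congr rfl fun i _ => Finset.sum_congr rfl fun j _ => by ring
  have h2 : ‖E‖ ^ 2 = ∑ p : ι × ι, E p.1 p.2 ^ 2 := by
    rw [Matrix.frobenius_norm_def, ← Real.sqrt_eq_rpow, Real.sq_sqrt (by positivity),
      Fintype.sum_prod_type]
    simp
  have h3 : (v ⬝ᵥ v) ^ 2 = ∑ p : ι × ι, (v p.1 * v p.2) ^ 2 := by
    rw [sq, dotProduct, Finset.sum_mul_sum, Fintype.sum_prod_type]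
    exact Finset.sum_congr rfl fun i _ => Finset.sum_congr rfl fun j _ => by ring
  apply abs_le_of_sq_le_sq _ (by positivity)
  rw [h1, mul_pow, h2, h3]
  exact Finset.sum_mul_sq_le_sq_mul_sq _ _ _

theorem abs_trace_mul_le (A B : Matrix ι ι ℝ) : |(A * B).trace| ≤ ‖A‖ * ‖B‖ := by
  have hn : ∀ A : Matrix ι ι ℝ, ‖A‖ ^ 2 = ∑ p : ι × ι, A p.1 p.2 ^ 2 := fun A => by
    rw [Matrix.frobenius_norm_def, ← Real.sqrt_eq_rpow, Real.sq_sqrt (by positivity),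
      Fintype.sum_prod_type]
    simp
  have h1 : (A * B).trace = ∑ p : ι × ι, A p.1 p.2 * Bᵀ p.1 p.2 := by
    simp [Matrix.trace, Matrix.mul_apply, Fintype.sum_prod_type]
  apply abs_le_of_sq_le_sq _ (by positivity)
  rw [← Matrix.frobenius_norm_transpose B, mul_pow, hn, hn, h1]
  exact Finset.sum_mul_sq_le_sq_mul_sq _ _ _

variable [DecidableEq ι]

theorem posSemidef_add_smul_one {E : Matrix ι ι ℝ} (hE : E.IsHermitian) {c : ℝ} (hc : ‖E‖ ≤ c) :
    (E + c • 1).PosSemidef := by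
  refine .of_dotProduct_mulVec_nonneg (hE.add ?_) fun v => ?_
  · simp [Matrix.IsHermitian]
  · have h0 : 0 ≤ v ⬝ᵥ v := by simpa using dotProduct_star_self_nonneg v
    have := (abs_le.mp (abs_dotProduct_mulVec_le E v)).1
    simp only [star_trivial, add_mulVec, dotProduct_add, smul_mulVec, one_mulVec, dotProduct_smul,
      smul_eq_mul]
    nlinarith

/-- A positive semidefinite matrix `W` dominates a multiple of the projection onto its range: the
matrix `P` below is the orthogonal projection onto the kernel of `W`, and `c` is its smallest
nonzero eigenvalue. -/
theorem exists_kernel_projection {W : Matrix ι ι ℝ} (hW : W.PosSemidef) :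
    ∃ (P : Matrix ι ι ℝ) (c : ℝ), Pᵀ = P ∧ P * P = P ∧ W * P = 0 ∧ 0 < c ∧
      (W - c • (1 - P)).PosSemidef := by
  set d := hW.1.eigenvalues with hd
  have hd0 : ∀ i, 0 ≤ d i := hW.eigenvalues_nonneg
  set U : Matrix ι ι ℝ := hW.1.eigenvectorUnitary.1 with hU
  have hUU : Uᵀ * U = 1 := by
    have := Unitary.coe_star_mul_self hW.1.eigenvectorUnitary
    rwa [Matrix.star_eq_conjTranspose, Matrix.conjTranspose_eq_transpose_of_trivial] at this
  have hUU' : U * Uᵀ = 1 := mul_eq_one_comm.mp hUU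
  have hWd : W = U * diagonal d * Uᵀ := by
    have := hW.1.spectral_theorem
    rwa [Unitary.conjStarAlgAut_apply, Matrix.star_eq_conjTranspose,
      Matrix.conjTranspose_eq_transpose_of_trivial] at this
  obtain ⟨c, hc0, hc⟩ : ∃ c : ℝ, 0 < c ∧ ∀ i, d i ≠ 0 → c ≤ d i := by
    by_cases hne : (Finset.univ.filter fun i => d i ≠ 0).Nonempty
    · obtain ⟨i, hi, hmin⟩ := Finset.exists_min_image _ d hne
      exact ⟨d i, lt_of_le_of_ne (hd0 i) (Ne.symm (by simpa using hi)),
        fun j hj => hmin j (by simpa using hj)⟩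
    · exact ⟨1, one_pos, fun i hi => (hne ⟨i, by simpa using hi⟩).elim⟩
  set e : ι → ℝ := fun i => if d i = 0 then 1 else 0 with he
  have conj_mul : ∀ f g : ι → ℝ, (U * diagonal f * Uᵀ) * (U * diagonal g * Uᵀ)
      = U * diagonal (f * g) * Uᵀ := by
    intro f g
    calc _ = U * diagonal f * (Uᵀ * U) * diagonal g * Uᵀ := by simp only [Matrix.mul_assoc]
      _ = _ := by rw [hUU, Matrix.mul_one, Matrix.mul_assoc U, diagonal_mul_diagonal]; rfl
  refine ⟨U * diagonal e * Uᵀ, c, ?_, ?_, ?_, hc0, ?_⟩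
  · simp [Matrix.transpose_mul, Matrix.mul_assoc]
  · rw [conj_mul]
    congr 3
    ext i; simp [he]
  · rw [hWd, conj_mul]
    have : d * e = 0 := by ext i; simp [he]
    simp [this]
  · have : W - c • (1 - U * diagonal e * Uᵀ) =
        U * diagonal (fun i => d i - c * (1 - e i)) * Uᵀ := by
      have h1 : diagonal (fun i => d i - c * (1 - e i)) = diagonal d - c • (1 - diagonal e) := by
        ext i j
        by_cases hij : i = j <;> simp [hij, Matrix.diagonal]
      rw [h1, Matrix.mul_sub, Matrix.sub_mul, ← hWd, Matrix.mul_smul, Matrix.smul_mul,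
        Matrix.mul_sub, Matrix.sub_mul, Matrix.mul_one, hUU']
    rw [this]
    have h2 : (diagonal (fun i => d i - c * (1 - e i))).PosSemidef := by
      refine posSemidef_diagonal_iff.mpr fun i => ?_
      by_cases hi : d i = 0
      · simp [he, hi]
      · simpa [he, hi] using hc i hi
    simpa [Matrix.conjTranspose_eq_transpose_of_trivial] using h2.mul_mul_conjTranspose_same U

theorem Matrix.PosDef.exists_sub_smul_one {M : Matrix ι ι ℝ} (hM : M.PosDef) :
    ∃ c : ℝ, 0 < c ∧ (M - c • 1).PosSemidef := by
  obtain ⟨P, c, -, -, h, hc, h'⟩ := exists_kernel_projection hM.posSemidef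
  have : P = 0 := hM.isUnit.mul_left_cancel (by simpa using h)
  exact ⟨c, hc, by simpa [this] using h'⟩

/-- If a positive semidefinite matrix has small trace against `1 - P`, then it is close to its
compression to the range of `P`, at the rate of the square root. -/
theorem norm_mul_compl_sq_le {X P : Matrix ι ι ℝ} (hX : X.PosSemidef) (hP : Pᵀ = P)
    (hPP : P * P = P) : ‖X * (1 - P)‖ ^ 2 ≤ X.trace * ((1 - P) * X).trace := by
  obtain ⟨B, rfl⟩ := exists_eq_transpose_mul_self hX
  have h1 : ‖B * (1 - P)‖ ^ 2 = ((1 - P) * (Bᵀ * B)).trace := by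
    have hQ : (1 - P) * (1 - P) = 1 - P := by
      rw [Matrix.mul_sub, Matrix.sub_mul, Matrix.sub_mul, hPP]; simp
    rw [frobenius_norm_sq_eq_trace, Matrix.transpose_mul, Matrix.transpose_sub, hP,
      Matrix.transpose_one]
    rw [show (1 - P) * Bᵀ * (B * (1 - P)) = (1 - P) * (Bᵀ * B) * (1 - P) by
      simp only [Matrix.mul_assoc], Matrix.trace_mul_comm, ← Matrix.mul_assoc, hQ]
  rw [← h1, ← frobenius_norm_sq_eq_trace, ← mul_pow, Matrix.mul_assoc]
  gcongr
  simpa only [Matrix.frobenius_norm_transpose] using Matrix.frobenius_norm_mul Bᵀ (B * (1 - P))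

end Basics

/-! ### Regularity of subspaces and separation in normed spaces -/

section Normed

variable {E : Type*} [NormedAddCommGroup E] [NormedSpace ℝ E]

/-- Linear regularity of two subspaces: a point of `V` near `U` is proportionally near `V ⊓ U`. -/
theorem Submodule.exists_norm_sub_inf_le [FiniteDimensional ℝ E] (V U : Submodule ℝ E) :
    ∃ K : ℝ, 0 < K ∧ ∀ x ∈ V, ∀ y ∈ U, ∃ z ∈ V ⊓ U, ‖x - z‖ ≤ K * ‖x - y‖ := by
  set f : (V × U) →ₗ[ℝ] E := V.subtype.coprod (-U.subtype) with hf
  -- The open mapping theorem for `(a, b) ↦ a - b` splits `x - y` into small parts in `V` and `U`.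
  obtain ⟨K, hK, h⟩ := ContinuousLinearMap.exists_preimage_norm_le
    (LinearMap.toContinuousLinearMap f.rangeRestrict) f.surjective_rangeRestrict
  refine ⟨K, hK, fun x hx y hy => ?_⟩
  have hmem : x - y ∈ LinearMap.range f := ⟨(⟨x, hx⟩, ⟨y, hy⟩), by simp [hf, sub_eq_add_neg]⟩
  obtain ⟨⟨a, b⟩, hab, hle⟩ := h ⟨x - y, hmem⟩
  have hab' : (a : E) - b = x - y := by
    have := congrArg Subtype.val hab
    simpa [hf, sub_eq_add_neg] using this
  refine ⟨x - a, ⟨V.sub_mem hx a.2, ?_⟩, ?_⟩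
  · have : x - a = y - b := by rw [sub_eq_sub_iff_sub_eq_sub, ← hab']
    rw [this]
    exact U.sub_mem hy b.2
  · have h1 : ‖a‖ ≤ ‖(a, b)‖ := norm_fst_le (a, b)
    simpa using h1.trans hle

theorem Submodule.exists_norm_sub_ker_le (V : Submodule ℝ E) (g : E →ₗ[ℝ] ℝ) :
    ∃ K : ℝ, 0 ≤ K ∧ ∀ x ∈ V, ∃ z ∈ V, g z = 0 ∧ ‖x - z‖ ≤ K * |g x| := by
  by_cases h : ∀ x ∈ V, g x = 0
  · exact ⟨0, le_rfl, fun x hx => ⟨x, hx, h x hx, by simp⟩⟩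
  · push Not at h
    obtain ⟨w, hw, hgw⟩ := h
    refine ⟨‖(g w)⁻¹ • w‖, norm_nonneg _, fun x hx =>
      ⟨x - g x • (g w)⁻¹ • w, V.sub_mem hx (V.smul_mem _ (V.smul_mem _ hw)), ?_, ?_⟩⟩
    · simp [hgw]
    · rw [sub_sub_cancel, norm_smul, Real.norm_eq_abs, mul_comm]

/-- Theorem of the alternative for a convex cone `K` with interior point `e` and an affine subspace
`x₁ + V` through a point of `K`: either the affine subspace meets the interior of `K`, or it lies in
the kernel of a nonzero functional that is nonnegative on `K`. -/
theorem exists_ball_subset_or_exists_functional {K : Set E}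
    (hadd : ∀ x ∈ K, ∀ y ∈ K, x + y ∈ K) (hsmul : ∀ t : ℝ, 0 < t → ∀ x ∈ K, t • x ∈ K)
    {e : E} (he : Metric.ball e 1 ⊆ K) {x₁ : E} (hx₁ : x₁ ∈ K) (V : Submodule ℝ E) :
    (∃ D ∈ V, ∃ r > 0, Metric.ball (x₁ + D) r ⊆ K) ∨
      ∃ f : E →ₗ[ℝ] ℝ, f x₁ = 0 ∧ (∀ D ∈ V, f D = 0) ∧ (∀ x ∈ K, 0 ≤ f x) ∧ 0 < f e := by
  have hconv : Convex ℝ K := by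
    refine convex_iff_forall_pos.mpr fun x hx y hy a b ha hb _ => ?_
    exact hadd _ (hsmul a ha x hx) _ (hsmul b hb y hy)
  have hint : ∀ x ∈ K, ∀ c : ℝ, 0 < c → x + c • e ∈ interior K := by
    intro x hx c hc
    refine mem_interior.mpr ⟨Metric.ball (x + c • e) c, fun y hy => ?_, Metric.isOpen_ball,
      Metric.mem_ball_self hc⟩
    have : c⁻¹ • (y - x) ∈ K := he <| by
      rw [Metric.mem_ball, dist_eq_norm] at hy ⊢
      have h1 : c⁻¹ • (y - x) - e = c⁻¹ • (y - (x + c • e)) := by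
        rw [← sub_sub, smul_sub c⁻¹ (y - x), inv_smul_smul₀ hc.ne']
      rw [h1, norm_smul, Real.norm_eq_abs, abs_of_pos (inv_pos.mpr hc)]
      rwa [inv_mul_lt_iff₀ hc, mul_one]
    have h2 := hadd _ hx _ (hsmul c hc _ this)
    rwa [smul_inv_smul₀ hc.ne', add_sub_cancel] at h2
  by_cases hdis : ∃ D ∈ V, x₁ + D ∈ interior K
  · obtain ⟨D, hD, hD'⟩ := hdis
    obtain ⟨r, hr, hb⟩ := Metric.isOpen_iff.mp isOpen_interior _ hD'
    exact .inl ⟨D, hD, r, hr, hb.trans interior_subset⟩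
  right
  push Not at hdis
  obtain ⟨f, s, hf, hs⟩ := geometric_hahn_banach_open (s := interior K)
    (t := (fun D => x₁ + D) '' (V : Set E)) hconv.interior isOpen_interior
    (V.convex.translate x₁) (by
      rw [Set.disjoint_left]
      rintro _ hK ⟨D, hD, rfl⟩
      exact hdis D hD hK)
  have hs' : ∀ D ∈ V, s ≤ f x₁ + f D := fun D hD => by simpa using hs _ ⟨D, hD, rfl⟩
  have hlt : ∀ x ∈ K, ∀ t : ℝ, 0 < t → ∀ c : ℝ, 0 < c → t * f x + c * f e < s := by
    intro x hx t ht c hc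
    simpa using hf _ (hint _ (hsmul t ht x hx) c hc)
  -- A functional bounded above on a cone is nonpositive there.
  have hnonpos : ∀ x ∈ K, f x ≤ 0 := by
    intro x hx
    by_contra! hpos
    have := hlt x hx ((|s| + |f e|) / f x + 1) (by positivity) 1 one_pos
    rw [add_mul, div_mul_cancel₀ _ hpos.ne'] at this
    linarith [le_abs_self s, neg_abs_le (f e)]
  -- Small multiples of `e` lie in the interior, with functional values tending to `0`.
  have hs0 : 0 ≤ s := by
    by_contra! hneg
    have hs_pos : 0 < -s := neg_pos.mpr hneg
    have heK : e ∈ K := he (Metric.mem_ball_self one_pos)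
    set a := f e with ha
    have h1 := hlt e heK (-s / (2 * (|a| + 1)) / 2) (by positivity) (-s / (2 * (|a| + 1)) / 2)
      (by positivity)
    have h2 : -s / (2 * (|a| + 1)) * (2 * (|a| + 1)) = -s := div_mul_cancel₀ _ (by positivity)
    have h3 : 0 < -s / (2 * (|a| + 1)) := by positivity
    nlinarith [neg_abs_le a]
  have hx0 : f x₁ = 0 := le_antisymm (hnonpos _ hx₁) (hs0.trans (by simpa using hs' 0 V.zero_mem))
  have hV : ∀ D ∈ V, 0 ≤ f D := fun D hD => by linarith [hs' D hD]
  have hs00 : s ≤ 0 := by simpa [hx0] using hs' 0 V.zero_mem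
  refine ⟨-f, by simp [hx0], fun D hD => ?_, fun x hx => by simpa using hnonpos x hx, ?_⟩
  · have h1 := hV D hD
    have h2 := hV (-D) (V.neg_mem hD)
    simp only [map_neg] at h2
    simp; linarith
  · have h1 := hlt x₁ hx₁ 1 one_pos 1 one_pos
    rw [hx0] at h1
    simp; linarith

end Normed

/-! ### Error bounds on a face of the positive semidefinite cone -/

section ErrorBound

variable {ι : Type*} [Fintype ι] [DecidableEq ι]

/-- The matrices `D` with `P D P = D`. For an orthogonal projection `P`, the positive semidefinite
matrices among them form a face of the cone. -/
def compressedMatrices (P : Matrix ι ι ℝ) : Submodule ℝ (Matrix ι ι ℝ) where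
  carrier := {D | P * D * P = D}
  add_mem' {a b} ha hb := by
    simp only [Set.mem_ofPred_eq] at *
    rw [Matrix.mul_add, Matrix.add_mul, ha, hb]
  zero_mem' := by simp
  smul_mem' c a ha := by
    simp only [Set.mem_ofPred_eq] at *
    rw [Matrix.mul_smul, Matrix.smul_mul, ha]

theorem mem_compressedMatrices {P D : Matrix ι ι ℝ} :
    D ∈ compressedMatrices P ↔ P * D * P = D := Iff.rfl

/-- Hölder error bound with exponent `1 / k`, on bounded sets, for the intersection of the affine
space `X₁ + V` with the positive semidefinite cone: a point `X₁ + D` of the affine space whose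
smallest eigenvalue is at least `-δ` is within `(K * δ) ^ (1 / k)` of the intersection. -/
def HolderErrorBound (X₁ : Matrix ι ι ℝ) (V : Submodule ℝ (Matrix ι ι ℝ)) (k : ℕ) : Prop :=
  ∀ R : ℝ, ∃ K : ℝ, 0 < K ∧ ∀ δ : ℝ, 0 ≤ δ → δ ≤ R → ∀ D ∈ V, ‖D‖ ≤ R →
    (X₁ + D + δ • 1).PosSemidef →
    ∃ E ∈ V, (X₁ + E).PosSemidef ∧ ‖D - E‖ ^ k ≤ K * δ

/-- If the affine space contains a relative interior point `X₁ + D₀` of the face of `P`, then moving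
a nearly positive semidefinite point towards it repairs the defect, and the bound is linear. -/
theorem holderErrorBound_one_of_slater {X₁ P : Matrix ι ι ℝ} {V : Submodule ℝ (Matrix ι ι ℝ)}
    (hP : Pᵀ = P) (hPP : P * P = P) (hX₁ : X₁ ∈ compressedMatrices P)
    (hV : V ≤ compressedMatrices P) {D₀ : Matrix ι ι ℝ} (hD₀ : D₀ ∈ V) {c : ℝ} (hc : 0 < c)
    (h : (X₁ + D₀ - c • P).PosSemidef) : HolderErrorBound X₁ V 1 := by
  intro R
  refine ⟨(|R| + ‖D₀‖ + 1) / c, by positivity, fun δ hδ _ D hD hDR hpsd => ?_⟩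
  have hcδ : 0 < c + δ := by linarith
  refine ⟨(c + δ)⁻¹ • (c • D + δ • D₀), V.smul_mem _ (V.add_mem (V.smul_mem _ hD)
    (V.smul_mem _ hD₀)), ?_, ?_⟩
  · have h1 : (X₁ + D + δ • P).PosSemidef := by
      have := posSemidef_conj hpsd hP
      rwa [Matrix.mul_add, Matrix.add_mul, Matrix.mul_add, Matrix.add_mul,
        mem_compressedMatrices.mp hX₁, mem_compressedMatrices.mp (hV hD), Matrix.mul_smul,
        Matrix.mul_one, Matrix.smul_mul, hPP] at this
    have h2 : X₁ + (c + δ)⁻¹ • (c • D + δ • D₀) =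
        (c + δ)⁻¹ • (c • (X₁ + D + δ • P) + δ • (X₁ + D₀ - c • P)) := by
      rw [eq_inv_smul_iff₀ hcδ.ne', smul_add, smul_inv_smul₀ hcδ.ne']
      module
    rw [h2]
    exact ((h1.smul hc.le).add (h.smul hδ)).smul (inv_nonneg.mpr hcδ.le)
  · have h2 : D - (c + δ)⁻¹ • (c • D + δ • D₀) = (c + δ)⁻¹ • δ • (D - D₀) := by
      rw [eq_inv_smul_iff₀ hcδ.ne', smul_sub, smul_inv_smul₀ hcδ.ne']
      module
    rw [h2, pow_one, norm_smul, norm_smul, Real.norm_of_nonneg (inv_nonneg.mpr hcδ.le),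
      Real.norm_of_nonneg hδ]
    have h3 : ‖D - D₀‖ ≤ |R| + ‖D₀‖ + 1 := by
      linarith [norm_sub_le D D₀, le_abs_self R]
    have h4 : (c + δ)⁻¹ ≤ c⁻¹ := inv_anti₀ hc (by linarith)
    calc (c + δ)⁻¹ * (δ * ‖D - D₀‖) ≤ c⁻¹ * (δ * (|R| + ‖D₀‖ + 1)) := by gcongr
      _ = _ := by ring

/-- The square-root estimate behind one step of facial reduction, in a form uniform over bounded
sets: if `W ⪰ 0` is orthogonal to `X` and `X ⪰ -δ`, then `X` is within `O(√δ)` of its compression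
to the kernel of `W`. -/
theorem exists_norm_sub_compression_sq_le {W P : Matrix ι ι ℝ} (hP : Pᵀ = P) (hPP : P * P = P)
    {c : ℝ} (hc : 0 < c) (hW : (W - c • (1 - P)).PosSemidef) (R : ℝ) :
    ∃ K : ℝ, 0 < K ∧ ∀ δ : ℝ, 0 ≤ δ → δ ≤ R → ∀ X : Matrix ι ι ℝ, ‖X‖ ≤ R →
      (X + δ • 1).PosSemidef → (W * X).trace = 0 → ‖X - P * X * P‖ ^ 2 ≤ K * δ := by
  set o : ℝ := ‖(1 : Matrix ι ι ℝ)‖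
  set T : ℝ := |R| * o + |R| * |(1 : Matrix ι ι ℝ).trace|
  refine ⟨2 * (1 + ‖P‖) ^ 2 * (T * (|W.trace| / c)) + 2 * (|R| * ‖1 - P‖ ^ 2) + 1, by positivity,
    fun δ hδ hδR X hX hpsd htr => ?_⟩
  set X' := X + δ • (1 : Matrix ι ι ℝ) with hX'
  have hT : X'.trace ≤ T := by
    have h1 : X.trace ≤ |R| * o := by
      have := abs_trace_mul_le X 1
      rw [Matrix.mul_one] at this
      exact (le_abs_self _).trans (this.trans (by gcongr; exact hX.trans (le_abs_self R)))
    have h2 : (δ • (1 : Matrix ι ι ℝ)).trace ≤ |R| * |(1 : Matrix ι ι ℝ).trace| := by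
      rw [Matrix.trace_smul, smul_eq_mul]
      have := hδR.trans (le_abs_self R)
      have h3 : 0 ≤ (1 : Matrix ι ι ℝ).trace := Matrix.PosSemidef.one.trace_nonneg
      rw [abs_of_nonneg h3]
      gcongr
    rw [hX', Matrix.trace_add]
    exact add_le_add h1 h2
  have hQ : ((1 - P) * X').trace ≤ |W.trace| / c * δ := by
    have h1 := trace_mul_nonneg_of_posSemidef hW hpsd
    rw [Matrix.sub_mul, Matrix.trace_sub, Matrix.smul_mul, Matrix.trace_smul, hX', Matrix.mul_add,
      Matrix.trace_add, htr, Matrix.mul_smul, Matrix.mul_one, Matrix.trace_smul, ← hX'] at h1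
    simp only [smul_eq_mul] at h1
    rw [div_mul_eq_mul_div, le_div_iff₀ hc]
    nlinarith [le_abs_self W.trace]
  have h3 : ‖X' * (1 - P)‖ ^ 2 ≤ T * (|W.trace| / c * δ) :=
    (norm_mul_compl_sq_le hpsd hP hPP).trans 
      ((mul_le_mul_of_nonneg_left hQ hpsd.trace_nonneg).trans (by gcongr))
  have h4 : ‖(1 - P) * X'‖ = ‖X' * (1 - P)‖ := by
    rw [← Matrix.frobenius_norm_transpose, Matrix.transpose_mul, Matrix.transpose_sub, hP,
      Matrix.transpose_one, ← Matrix.conjTranspose_eq_transpose_of_trivial X', hpsd.1]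
  have h5 : X - P * X * P = (X' * (1 - P) + (1 - P) * X' * P) - δ • (1 - P) := by
    have : P * X' * P = P * X * P + δ • P := by
      rw [hX', Matrix.mul_add, Matrix.add_mul, Matrix.mul_smul, Matrix.mul_one, Matrix.smul_mul,
        hPP]
    rw [Matrix.mul_sub, Matrix.sub_mul, Matrix.sub_mul, Matrix.mul_one, Matrix.one_mul, this, hX']
    module
  have h6 : ‖X - P * X * P‖ ≤ (1 + ‖P‖) * ‖X' * (1 - P)‖ + δ * ‖1 - P‖ := by
    rw [h5]
    refine (norm_sub_le _ _).trans (add_le_add ((norm_add_le _ _).trans ?_) ?_)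
    · have := Matrix.frobenius_norm_mul ((1 - P) * X') P
      rw [h4] at this
      linarith
    · rw [norm_smul, Real.norm_of_nonneg hδ]
  calc ‖X - P * X * P‖ ^ 2 ≤ ((1 + ‖P‖) * ‖X' * (1 - P)‖ + δ * ‖1 - P‖) ^ 2 := by gcongr
    _ ≤ 2 ^ (2 - 1) * (((1 + ‖P‖) * ‖X' * (1 - P)‖) ^ 2 + (δ * ‖1 - P‖) ^ 2) :=
      add_pow_le (by positivity) (by positivity) 2
    _ = 2 * (1 + ‖P‖) ^ 2 * ‖X' * (1 - P)‖ ^ 2 + 2 * (δ * ‖1 - P‖ ^ 2) * δ := by ring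
    _ ≤ 2 * (1 + ‖P‖) ^ 2 * (T * (|W.trace| / c * δ)) + 2 * (|R| * ‖1 - P‖ ^ 2) * δ := by
      have := hδR.trans (le_abs_self R)
      gcongr
    _ ≤ _ := by nlinarith

end ErrorBound

/-! ### Facial reduction -/

section FacialReduction

variable {ι : Type*} [Fintype ι] [DecidableEq ι]

theorem mem_compressedMatrices_of_trace_eq_zero {W P X : Matrix ι ι ℝ} (hP : Pᵀ = P)
    (hPP : P * P = P) {c : ℝ} (hc : 0 < c) (hW : (W - c • (1 - P)).PosSemidef)
    (hX : X.PosSemidef) (htr : (W * X).trace = 0) : X ∈ compressedMatrices P := by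
  obtain ⟨K, -, h⟩ := exists_norm_sub_compression_sq_le hP hPP hc hW ‖X‖
  have := h 0 le_rfl (norm_nonneg _) X le_rfl (by simpa using hX) htr
  rw [mul_zero] at this
  have h0 : ‖X - P * X * P‖ = 0 := pow_eq_zero_iff (two_ne_zero) |>.mp
    (le_antisymm this (by positivity))
  exact (sub_eq_zero.mp (norm_eq_zero.mp h0)).symm

/-- One step of facial reduction: passing from the face exposed by `W` back to the whole cone
doubles the denominator of the Hölder exponent. -/
theorem HolderErrorBound.of_face {X₁ W P : Matrix ι ι ℝ} {V : Submodule ℝ (Matrix ι ι ℝ)} {k : ℕ}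
    (hk : 1 ≤ k) (hP : Pᵀ = P) (hPP : P * P = P) {c : ℝ} (hc : 0 < c)
    (hW : (W - c • (1 - P)).PosSemidef) (hX₁ : X₁.PosSemidef) (hWX₁ : (W * X₁).trace = 0)
    (hWV : ∀ D ∈ V, (W * D).trace = 0) (hVs : ∀ D ∈ V, D.IsHermitian)
    (h : HolderErrorBound X₁ (V ⊓ compressedMatrices P) k) : HolderErrorBound X₁ V (2 * k) := by
  intro R
  wlog hR : 0 ≤ R
  · exact ⟨1, one_pos, fun δ h0 h1 => absurd (h0.trans h1) hR⟩
  have hX₁P := mem_compressedMatrices_of_trace_eq_zero hP hPP hc hW hX₁ hWX₁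
  obtain ⟨K₁, hK₁, hface⟩ := exists_norm_sub_compression_sq_le hP hPP hc hW (‖X₁‖ + R)
  obtain ⟨K₂, hK₂, hreg⟩ := V.exists_norm_sub_inf_le (compressedMatrices P)
  set K := K₂ ^ 2 * K₁ with hK
  obtain ⟨K₃, hK₃, hrec⟩ := h (R + √(K * R))
  refine ⟨2 ^ (2 * k - 1) * (K ^ k * R ^ (k - 1) + K₃ ^ 2 * (2 * (R + K))), by positivity,
    fun δ hδ hδR D hD hDR hpsd => ?_⟩
  have hcomp : ‖D - P * D * P‖ ^ 2 ≤ K₁ * δ := by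
    have h1 := hface δ hδ (hδR.trans (by linarith [norm_nonneg X₁])) (X₁ + D)
      ((norm_add_le _ _).trans (by gcongr)) hpsd
      (by rw [Matrix.mul_add, Matrix.trace_add, hWX₁, hWV D hD, add_zero])
    rwa [Matrix.mul_add, Matrix.add_mul, mem_compressedMatrices.mp hX₁P, add_sub_add_left_eq_sub]
      at h1
  have hmem : P * D * P ∈ compressedMatrices P := by
    rw [mem_compressedMatrices]
    calc P * (P * D * P) * P = (P * P) * D * (P * P) := by simp only [Matrix.mul_assoc]
      _ = _ := by rw [hPP]
  obtain ⟨E, hE, hDE⟩ := hreg D hD _ hmem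
  set η := ‖D - E‖ with hη
  have hη0 : 0 ≤ η := norm_nonneg _
  have hη2 : η ^ 2 ≤ K * δ := by
    calc η ^ 2 ≤ (K₂ * ‖D - P * D * P‖) ^ 2 := by gcongr
      _ = K₂ ^ 2 * ‖D - P * D * P‖ ^ 2 := by ring
      _ ≤ K₂ ^ 2 * (K₁ * δ) := by gcongr
      _ = K * δ := by rw [hK]; ring
  have hη1 : η ≤ √(K * R) := Real.le_sqrt_of_sq_le (hη2.trans (by gcongr))
  -- Moving from `D` to `E` costs at most `η` in the smallest eigenvalue.
  have hpsd' : (X₁ + E + (δ + η) • 1).PosSemidef := by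
    have h1 : (E - D + η • 1).PosSemidef :=
      posSemidef_add_smul_one ((hVs E hE.1).sub (hVs D hD)) (norm_sub_rev E D).le
    convert hpsd.add h1 using 1
    module
  obtain ⟨G, hG, hGpsd, hEG⟩ := hrec (δ + η) (by positivity) (by gcongr) E hE
    (by
      have : ‖E‖ ≤ ‖D‖ + ‖D - E‖ := by
        simpa using norm_sub_le D (D - E)
      linarith) hpsd'
  refine ⟨G, hG.1, hGpsd, ?_⟩
  have h1 : ‖D - G‖ ≤ η + ‖E - G‖ := by simpa using norm_add_le (D - E) (E - G)
  have h2 : η ^ (2 * k) ≤ K ^ k * R ^ (k - 1) * δ := by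
    rw [pow_mul]
    calc (η ^ 2) ^ k ≤ (K * δ) ^ k := by gcongr
      _ = K ^ k * (δ ^ (k - 1) * δ) := by rw [mul_pow, ← pow_succ, Nat.sub_add_cancel hk]
      _ ≤ K ^ k * (R ^ (k - 1) * δ) := by gcongr
      _ = _ := by ring
  have h3 : ‖E - G‖ ^ (2 * k) ≤ K₃ ^ 2 * (2 * (R + K)) * δ := by
    rw [mul_comm 2 k, pow_mul]
    calc (‖E - G‖ ^ k) ^ 2 ≤ (K₃ * (δ + η)) ^ 2 := by gcongr
      _ = K₃ ^ 2 * (δ + η) ^ 2 := by ring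
      _ ≤ K₃ ^ 2 * (2 * (R + K) * δ) := by
        gcongr
        nlinarith [sq_nonneg (δ - η), mul_le_mul_of_nonneg_right hδR hδ]
      _ = _ := by ring
  calc ‖D - G‖ ^ (2 * k) ≤ (η + ‖E - G‖) ^ (2 * k) := by gcongr
    _ ≤ 2 ^ (2 * k - 1) * (η ^ (2 * k) + ‖E - G‖ ^ (2 * k)) :=
      add_pow_le hη0 (norm_nonneg _) _
    _ ≤ 2 ^ (2 * k - 1) * (K ^ k * R ^ (k - 1) * δ + K₃ ^ 2 * (2 * (R + K)) * δ) := by gcongr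
    _ = _ := by ring

/-- Either `X₁ + V` contains a relative interior point of the face of `P`, or a nonzero positive
semidefinite matrix supported on the range of `P` is orthogonal to it. -/
theorem slater_or_exists_exposing {X₁ P : Matrix ι ι ℝ} {V : Submodule ℝ (Matrix ι ι ℝ)}
    (hP : Pᵀ = P) (hPP : P * P = P) (hX₁ : X₁.PosSemidef) (hX₁P : X₁ ∈ compressedMatrices P)
    (hV : V ≤ compressedMatrices P) (hVs : ∀ D ∈ V, D.IsHermitian) :
    (∃ D ∈ V, ∃ c : ℝ, 0 < c ∧ (X₁ + D - c • P).PosSemidef) ∨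
      ∃ W : Matrix ι ι ℝ, W.PosSemidef ∧ P * W * P = W ∧ W ≠ 0 ∧ (W * X₁).trace = 0 ∧
        ∀ D ∈ V, (W * D).trace = 0 := by
  have hquad : ∀ (X : Matrix ι ι ℝ) (v : ι → ℝ),
      v ⬝ᵥ (P * X * P) *ᵥ v = (P *ᵥ v) ⬝ᵥ X *ᵥ (P *ᵥ v) := by
    intro X v
    rw [← Matrix.mulVec_mulVec, ← Matrix.mulVec_mulVec, Matrix.dotProduct_mulVec,
      ← Matrix.mulVec_transpose, hP]
  have hPh : P.IsHermitian := by
    rw [Matrix.IsHermitian, Matrix.conjTranspose_eq_transpose_of_trivial, hP]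
  -- `K` is not restricted to symmetric matrices, so that it has interior in the matrix space.
  set K : Set (Matrix ι ι ℝ) := {X | ∀ v, 0 ≤ (P *ᵥ v) ⬝ᵥ X *ᵥ (P *ᵥ v)} with hK
  have hpsdK : ∀ X : Matrix ι ι ℝ, X.PosSemidef → X ∈ K := fun X hX v => by
    simpa using hX.dotProduct_mulVec_nonneg (P *ᵥ v)
  have hball : Metric.ball (1 : Matrix ι ι ℝ) 1 ⊆ K := by
    intro X hX v
    rw [Metric.mem_ball, dist_eq_norm] at hX
    set u := P *ᵥ v
    have h0 : 0 ≤ u ⬝ᵥ u := by simpa using dotProduct_star_self_nonneg u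
    have h1 := (abs_le.mp (abs_dotProduct_mulVec_le (X - 1) u)).1
    rw [Matrix.sub_mulVec, dotProduct_sub, Matrix.one_mulVec] at h1
    nlinarith
  rcases exists_ball_subset_or_exists_functional (K := K)
    (fun x hx y hy v => by
      rw [Matrix.add_mulVec, dotProduct_add]; exact add_nonneg (hx v) (hy v))
    (fun t ht x hx v => by
      rw [Matrix.smul_mulVec, dotProduct_smul]; exact mul_nonneg ht.le (hx v))
    hball (hpsdK X₁ hX₁) V with ⟨D, hD, r, hr, hsub⟩ | ⟨f, hf1, hfV, hfK, hfe⟩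
  · left
    refine ⟨D, hD, r / (2 * (‖(1 : Matrix ι ι ℝ)‖ + 1)), by positivity, ?_⟩
    set c := r / (2 * (‖(1 : Matrix ι ι ℝ)‖ + 1)) with hc
    have hmem : X₁ + D - c • (1 : Matrix ι ι ℝ) ∈ K := hsub <| by
      rw [Metric.mem_ball, dist_eq_norm, sub_sub_cancel_left, norm_neg, norm_smul,
        Real.norm_of_nonneg (by positivity)]
      have : c * (2 * (‖(1 : Matrix ι ι ℝ)‖ + 1)) = r := div_mul_cancel₀ _ (by positivity)
      have hc0 : 0 < c := by positivity
      nlinarith [norm_nonneg (1 : Matrix ι ι ℝ)]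
    refine .of_dotProduct_mulVec_nonneg ((hX₁.1.add (hVs D hD)).sub (by
      rw [Matrix.IsHermitian, Matrix.conjTranspose_smul, hPh, star_trivial])) fun v => ?_
    have h1 : P * (X₁ + D - c • 1) * P = X₁ + D - c • P := by
      rw [Matrix.mul_sub, Matrix.sub_mul, Matrix.mul_add, Matrix.add_mul,
        mem_compressedMatrices.mp hX₁P, mem_compressedMatrices.mp (hV hD), Matrix.mul_smul,
        Matrix.mul_one, Matrix.smul_mul, hPP]
    rw [← h1, star_trivial, hquad]
    exact hmem v
  · right
    set W₀ : Matrix ι ι ℝ := Matrix.of fun i j => f (Matrix.single i j 1) with hW₀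
    have hf : ∀ X : Matrix ι ι ℝ, (W₀ᵀ * X).trace = f X := by
      intro X
      conv_rhs => rw [Matrix.matrix_eq_sum_single X]
      simp only [map_sum, Matrix.trace, Matrix.diag, Matrix.mul_apply, Matrix.transpose_apply]
      rw [Finset.sum_comm]
      refine Finset.sum_congr rfl fun i _ => Finset.sum_congr rfl fun j _ => ?_
      have h1 : Matrix.single i j (X i j) = X i j • Matrix.single i j (1 : ℝ) := by
        rw [Matrix.smul_single, smul_eq_mul, mul_one]
      rw [h1, map_smul, smul_eq_mul, mul_comm, hW₀, Matrix.of_apply]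
    -- Only the part of `f` acting on symmetric matrices supported on the range of `P` matters.
    set W : Matrix ι ι ℝ := P * (W₀ + W₀ᵀ) * P with hW
    have htr : ∀ X : Matrix ι ι ℝ, (W * X).trace = f (P * X * P) + f (P * Xᵀ * P) := by
      intro X
      rw [← hf, ← hf]
      have h1 : (W * X).trace = ((W₀ + W₀ᵀ) * (P * X * P)).trace := by
        rw [hW, Matrix.mul_assoc _ P X, Matrix.mul_assoc P, Matrix.trace_mul_comm P,
          Matrix.mul_assoc]
      have h2 : (W₀ * (P * X * P)).trace = (W₀ᵀ * (P * Xᵀ * P)).trace := by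
        rw [← Matrix.trace_transpose, Matrix.trace_mul_comm W₀ᵀ]
        simp [Matrix.transpose_mul, hP, Matrix.mul_assoc]
      rw [h1, Matrix.add_mul, Matrix.trace_add, h2, add_comm]
    have htrc : ∀ X : Matrix ι ι ℝ, X.IsHermitian → X ∈ compressedMatrices P → f X = 0 →
        (W * X).trace = 0 := by
      intro X hX hXP hfX
      rw [Matrix.IsHermitian, Matrix.conjTranspose_eq_transpose_of_trivial] at hX
      rw [htr, hX, mem_compressedMatrices.mp hXP, hfX, add_zero]
    have hWs : Wᵀ = W := by
      simp [hW, Matrix.transpose_mul, hP, Matrix.mul_assoc, add_comm]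
    refine ⟨W, .of_dotProduct_mulVec_nonneg ?_ fun v => ?_, ?_, ?_, htrc _ hX₁.1 hX₁P hf1,
      fun D hD => htrc D (hVs D hD) (hV hD) (hfV D hD)⟩
    · rw [Matrix.IsHermitian, Matrix.conjTranspose_eq_transpose_of_trivial, hWs]
    · have hvv : (vecMulVec v v).PosSemidef := by simpa using posSemidef_vecMulVec_self_star v
      have h1 : star v ⬝ᵥ W *ᵥ v = (W * vecMulVec v v).trace := by
        rw [Matrix.mul_vecMulVec, Matrix.trace_vecMulVec, dotProduct_comm, star_trivial]
      have h2 := hfK _ (hpsdK _ (posSemidef_conj hvv hP))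
      rw [h1, htr, Matrix.transpose_vecMulVec]
      linarith
    · calc P * (P * (W₀ + W₀ᵀ) * P) * P = (P * P) * (W₀ + W₀ᵀ) * (P * P) := by
            simp only [Matrix.mul_assoc]
        _ = W := by rw [hPP]
    · intro h0
      have h1 := htr 1
      have h2 : 0 ≤ f (P - 1) := hfK _ fun v => by
        rw [Matrix.sub_mulVec, Matrix.one_mulVec, Matrix.mulVec_mulVec, hPP]
        simp
      rw [h0, Matrix.transpose_one, Matrix.mul_one, Matrix.mul_one, hPP, Matrix.trace_zero] at h1
      rw [map_sub] at h2
      linarith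

theorem rank_lt_of_mul_eq {P P' : Matrix ι ι ℝ} (hP' : P' * P' = P')
    (h : P * P' = P') (h' : P' * P = P') (hne : P' ≠ P) : P'.rank < P.rank := by
  have hle : LinearMap.range P'.mulVecLin ≤ LinearMap.range P.mulVecLin := by
    rintro _ ⟨v, rfl⟩
    exact ⟨P' *ᵥ v, by simp [Matrix.mulVec_mulVec, h]⟩
  by_contra! hr
  have heq := Submodule.eq_of_le_of_finrank_le hle hr
  refine hne ?_
  rw [← h']
  refine Matrix.ext_of_mulVec_single fun i => ?_
  have hm : P *ᵥ Pi.single i 1 ∈ LinearMap.range P'.mulVecLin := heq ▸ ⟨_, rfl⟩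
  obtain ⟨w, hw⟩ := hm
  rw [← Matrix.mulVec_mulVec, ← hw, Matrix.mulVecLin_apply, Matrix.mulVec_mulVec, hP']

/-- Sturm's error bound on the face of `P`, by induction on the rank of `P`. -/
theorem exists_holderErrorBound_of_le {X₁ P : Matrix ι ι ℝ} {V : Submodule ℝ (Matrix ι ι ℝ)}
    (hP : Pᵀ = P) (hPP : P * P = P) (hX₁ : X₁.PosSemidef) (hX₁P : X₁ ∈ compressedMatrices P)
    (hV : V ≤ compressedMatrices P) (hVs : ∀ D ∈ V, D.IsHermitian) :
    ∃ k, 1 ≤ k ∧ HolderErrorBound X₁ V k := by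
  induction hr : P.rank using Nat.strong_induction_on generalizing P V with
  | _ r ih =>
  subst hr
  rcases slater_or_exists_exposing hP hPP hX₁ hX₁P hV hVs with
    ⟨D₀, hD₀, c, hc, h⟩ | ⟨W, hW, hPW, hW0, hWX, hWV⟩
  · exact ⟨1, le_rfl, holderErrorBound_one_of_slater hP hPP hX₁P hV hD₀ hc h⟩
  -- The kernel of `(1 - P) + W` is the part of the range of `P` killed by `W`.
  have hQ : (1 - P) * P = 0 := by rw [Matrix.sub_mul, hPP, Matrix.one_mul, sub_self]
  have hQtr : ∀ X ∈ compressedMatrices P, ((1 - P) * X).trace = 0 := fun X hX => by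
    rw [← mem_compressedMatrices.mp hX, ← Matrix.mul_assoc, ← Matrix.mul_assoc, hQ]; simp
  have hQpsd : (1 - P).PosSemidef := by
    have := posSemidef_conj (X := (1 : Matrix ι ι ℝ)) .one (P := 1 - P) (by simp [hP])
    rwa [Matrix.mul_one, Matrix.mul_sub, hQ, Matrix.mul_one, sub_zero] at this
  obtain ⟨P', c, hP', hPP', hker, hc, hdom⟩ := exists_kernel_projection (hQpsd.add hW)
  have hQP' : (1 - P) * P' = 0 := by
    have h1 : (1 - P) * (1 - P + W) = 1 - P := by
      rw [Matrix.mul_add, Matrix.mul_sub (1 - P), hQ, ← hPW, ← Matrix.mul_assoc, ← Matrix.mul_assoc,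
        hQ]
      simp
    rw [← h1, Matrix.mul_assoc, hker, Matrix.mul_zero]
  have hWP' : W * P' = 0 := by rwa [Matrix.add_mul, hQP', zero_add] at hker
  have h1 : P * P' = P' := by
    rw [Matrix.sub_mul, Matrix.one_mul, sub_eq_zero] at hQP'
    exact hQP'.symm
  have h2 : P' * P = P' := by
    have := congrArg Matrix.transpose h1
    rwa [Matrix.transpose_mul, hP, hP'] at this
  have hne : P' ≠ P := by
    rintro rfl
    exact hW0 (by rw [← hPW, Matrix.mul_assoc, hWP', Matrix.mul_zero])
  have htrX : ((1 - P + W) * X₁).trace = 0 := by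
    rw [Matrix.add_mul, Matrix.trace_add, hQtr X₁ hX₁P, hWX, add_zero]
  have hX₁P' := mem_compressedMatrices_of_trace_eq_zero hP' hPP' hc hdom hX₁ htrX
  obtain ⟨k, hk, hbound⟩ := ih _ (rank_lt_of_mul_eq hPP' h1 h2 hne) hP' hPP' hX₁P'
    (V := V ⊓ compressedMatrices P') inf_le_right (fun D hD => hVs D hD.1) rfl
  refine ⟨2 * k, by omega, HolderErrorBound.of_face hk hP' hPP' hc hdom hX₁ htrX (fun D hD => ?_)
    hVs hbound⟩
  rw [Matrix.add_mul, Matrix.trace_add, hQtr D (hV hD), hWV D hD, add_zero]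

theorem exists_holderErrorBound {X₁ : Matrix ι ι ℝ} {V : Submodule ℝ (Matrix ι ι ℝ)}
    (hX₁ : X₁.PosSemidef) (hVs : ∀ D ∈ V, D.IsHermitian) :
    ∃ k, 1 ≤ k ∧ HolderErrorBound X₁ V k :=
  exists_holderErrorBound_of_le (P := 1) (by simp) (by simp) hX₁ (by simp [mem_compressedMatrices])
    (fun D _ => by simp [mem_compressedMatrices]) hVs

end FacialReduction

/-! ### Trace functionals -/

section Duality

variable {ι : Type*} [Fintype ι]

theorem traceInner_of_isHermitian {n : ℕ} {X : Matrix (Fin n) (Fin n) ℝ} (hX : X.IsHermitian)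
    (Y : Matrix (Fin n) (Fin n) ℝ) : traceInner X Y = (X * Y).trace := by
  rw [Matrix.IsHermitian, Matrix.conjTranspose_eq_transpose_of_trivial] at hX
  rw [traceInner, hX]

/-- The linear functional `X ↦ tr(W X)`. -/
def traceMulLeft (W : Matrix ι ι ℝ) : Matrix ι ι ℝ →ₗ[ℝ] ℝ where
  toFun X := (W * X).trace
  map_add' X Y := by rw [Matrix.mul_add, Matrix.trace_add]
  map_smul' c X := by rw [Matrix.mul_smul, Matrix.trace_smul]; rfl

theorem traceMulLeft_apply (W X : Matrix ι ι ℝ) : traceMulLeft W X = (W * X).trace := rfl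

/-- A symmetric matrix orthogonal to all symmetric `D` with `⟨Bᵢ, D⟩ = 0` is in the span of
the `Bᵢ`. -/
theorem exists_eq_sum_smul_of_trace_eq_zero {κ : Type*} [Fintype κ] {B : κ → Matrix ι ι ℝ}
    {W : Matrix ι ι ℝ} (hB : ∀ i, (B i).IsHermitian) (hW : W.IsHermitian)
    (h : ∀ D : Matrix ι ι ℝ, D.IsHermitian → (∀ i, (B i * D).trace = 0) → (W * D).trace = 0) :
    ∃ y : κ → ℝ, W = ∑ i, y i • B i := by
  have hsymm : ∀ A X : Matrix ι ι ℝ, A.IsHermitian →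
      (A * (X + Xᵀ)).trace = 2 * (A * X).trace := by
    intro A X hA
    rw [Matrix.IsHermitian, Matrix.conjTranspose_eq_transpose_of_trivial] at hA
    have : (A * Xᵀ).trace = (A * X).trace := by
      rw [← Matrix.trace_transpose, Matrix.transpose_mul, Matrix.transpose_transpose, hA,
        Matrix.trace_mul_comm]
    rw [Matrix.mul_add, Matrix.trace_add, this]
    ring
  have hmem : traceMulLeft W ∈ Submodule.span ℝ (Set.range fun i => traceMulLeft (B i)) := by
    refine mem_span_of_iInf_ker_le_ker fun X hX => ?_
    rw [Submodule.mem_iInf] at hX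
    have h1 := h (X + Xᵀ) (by
      rw [Matrix.IsHermitian, Matrix.conjTranspose_eq_transpose_of_trivial, Matrix.transpose_add,
        Matrix.transpose_transpose, add_comm]) fun i => by
        rw [hsymm _ _ (hB i), show (B i * X).trace = 0 from hX i, mul_zero]
    rw [hsymm _ _ hW] at h1
    rw [LinearMap.mem_ker, traceMulLeft_apply]
    linarith
  obtain ⟨y, hy⟩ := (Submodule.mem_span_range_iff_exists_fun ℝ).mp hmem
  refine ⟨y, (Matrix.ext_iff_trace_mul_right).mpr fun X => ?_⟩
  have h1 := LinearMap.congr_fun hy X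
  simp only [LinearMap.sum_apply, LinearMap.smul_apply, traceMulLeft_apply, smul_eq_mul] at h1
  simp [Matrix.sum_mul, Matrix.trace_sum, ← h1]

/-! ### The penalty term, the Frobenius distance and the cone -/

theorem max_lambdaMax_neg_eq_zero {n : ℕ} {X : Matrix (Fin n) (Fin n) ℝ} (hX : X.PosSemidef) :
    max (lambdaMax (-X)) 0 = 0 := by
  refine max_eq_right (Real.sSup_nonpos fun x hx => ?_)
  rw [← spectrum.neg_eq, Set.mem_neg] at hx
  have := (Matrix.posSemidef_iff_isHermitian_and_spectrum_nonneg.mp hX).2 hx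
  simp only [Set.mem_ofPred_eq] at this
  linarith

/-- The penalty term measures the violation of the cone constraint. -/
theorem posSemidef_add_lambdaMax {n : ℕ} {X : Matrix (Fin n) (Fin n) ℝ} (hX : X.IsHermitian) :
    (X + max (lambdaMax (-X)) 0 • 1).PosSemidef := by
  set t := max (lambdaMax (-X)) 0 with ht
  have hone : (t • (1 : Matrix (Fin n) (Fin n) ℝ)).IsHermitian := by
    rw [Matrix.IsHermitian, Matrix.conjTranspose_smul, Matrix.conjTranspose_one, star_trivial]
  refine Matrix.posSemidef_iff_isHermitian_and_spectrum_nonneg.mpr ⟨hX.add hone, fun x hx => ?_⟩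
  rw [add_comm, ← Algebra.algebraMap_eq_smul_one, ← spectrum.vadd_eq, Set.mem_vadd_set] at hx
  obtain ⟨y, hy, rfl⟩ := hx
  have hbdd : BddAbove (spectrum ℝ (-X)) := Matrix.finite_real_spectrum.bddAbove
  have h1 : -y ≤ lambdaMax (-X) := le_csSup hbdd (by rw [← spectrum.neg_eq]; simpa using hy)
  have h2 : lambdaMax (-X) ≤ t := le_max_left _ _
  simp only [vadd_eq_add, Set.mem_ofPred_eq]
  linarith

theorem frobNorm_eq_norm {n : ℕ} (X : Matrix (Fin n) (Fin n) ℝ) : frobNorm X = ‖X‖ := by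
  rw [frobNorm, traceInner, ← frobenius_norm_sq_eq_trace, Real.sqrt_sq (norm_nonneg X)]

theorem frobDist_le {n : ℕ} {X Y : Matrix (Fin n) (Fin n) ℝ}
    {S : Set (Matrix (Fin n) (Fin n) ℝ)} (hY : Y ∈ S) : frobDist X S ≤ ‖Y - X‖ := by
  rw [← frobNorm_eq_norm]
  exact csInf_le ⟨0, by rintro _ ⟨Z, -, rfl⟩; exact Real.sqrt_nonneg _⟩ ⟨Y, hY, rfl⟩

theorem frobDist_nonneg {n : ℕ} (X : Matrix (Fin n) (Fin n) ℝ)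
    (S : Set (Matrix (Fin n) (Fin n) ℝ)) : 0 ≤ frobDist X S :=
  Real.sInf_nonneg (by rintro _ ⟨Z, -, rfl⟩; exact Real.sqrt_nonneg _)

theorem isClosed_posSemidef : IsClosed {X : Matrix ι ι ℝ | X.PosSemidef} := by
  simp only [Matrix.posSemidef_iff_dotProduct_mulVec, Set.ofPred_and, Set.ofPred_forall]
  refine IsClosed.inter (isClosed_eq (by fun_prop) (by fun_prop)) (isClosed_iInter fun v => ?_)
  exact isClosed_le (by fun_prop) (by fun_prop)

theorem abs_apply_le_frobenius_norm (X : Matrix ι ι ℝ) (i j : ι) : |X i j| ≤ ‖X‖ := by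
  refine abs_le_of_sq_le_sq ?_ (norm_nonneg _)
  rw [Matrix.frobenius_norm_def, ← Real.sqrt_eq_rpow, Real.sq_sqrt (by positivity)]
  simp only [Real.rpow_ofNat, Real.norm_eq_abs, sq_abs]
  exact (Finset.single_le_sum (f := fun j => X i j ^ 2) (fun _ _ => sq_nonneg _)
    (Finset.mem_univ j)).trans (Finset.single_le_sum (f := fun i => ∑ j, X i j ^ 2)
    (fun _ _ => by positivity) (Finset.mem_univ i))

end Duality

/-! ### Semidefinite programming duality -/

namespace SDPData

variable {n m : ℕ} (P : SDPData n m)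

/-- The direction space of the affine set `P.affineSet`. -/
def affineDirection : Submodule ℝ (Matrix (Fin n) (Fin n) ℝ) where
  carrier := {D | D.IsHermitian ∧ ∀ i, (P.A i * D).trace = 0}
  add_mem' {a b} ha hb := ⟨ha.1.add hb.1, fun i => by
    rw [Matrix.mul_add, Matrix.trace_add, ha.2 i, hb.2 i, add_zero]⟩
  zero_mem' := ⟨Matrix.isHermitian_zero, fun i => by simp⟩
  smul_mem' c a ha := ⟨by
    rw [Matrix.IsHermitian, Matrix.conjTranspose_smul, ha.1, star_trivial], fun i => by
    rw [Matrix.mul_smul, Matrix.trace_smul, ha.2 i, smul_zero]⟩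

variable {P}

theorem mem_affineSet {X : Matrix (Fin n) (Fin n) ℝ} :
    X ∈ P.affineSet ↔ X.IsHermitian ∧ ∀ i, (P.A i * X).trace = P.b i := by
  simp only [affineSet, Set.mem_ofPred_eq, traceInner_of_isHermitian (P.A_symm _)]

theorem add_mem_affineSet {X D : Matrix (Fin n) (Fin n) ℝ} (hX : X ∈ P.affineSet)
    (hD : D ∈ P.affineDirection) : X + D ∈ P.affineSet := by
  rw [mem_affineSet] at *
  exact ⟨hX.1.add hD.1, fun i => by
    rw [Matrix.mul_add, Matrix.trace_add, hX.2 i, hD.2 i, add_zero]⟩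

theorem sub_mem_affineDirection {X Y : Matrix (Fin n) (Fin n) ℝ} (hX : X ∈ P.affineSet)
    (hY : Y ∈ P.affineSet) : X - Y ∈ P.affineDirection := by
  rw [mem_affineSet] at *
  exact ⟨hX.1.sub hY.1, fun i => by
    rw [Matrix.mul_sub, Matrix.trace_sub, hX.2 i, hY.2 i, sub_self]⟩

/-- On the affine set, the slack `Z = C - ∑ yᵢ Aᵢ` represents the objective up to the constant
`bᵀ y`. -/
theorem trace_slack_mul {y : Fin m → ℝ} {Z X : Matrix (Fin n) (Fin n) ℝ}
    (h : Z + ∑ i, y i • P.A i = P.C) (hX : X ∈ P.affineSet) :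
    (Z * X).trace = traceInner P.C X - P.b ⬝ᵥ y := by
  rw [traceInner_of_isHermitian P.C_symm, ← h, Matrix.add_mul, Matrix.trace_add, Matrix.sum_mul,
    Matrix.trace_sum]
  have : ∑ i, ((y i • P.A i) * X).trace = P.b ⬝ᵥ y := by
    refine Finset.sum_congr rfl fun i _ => ?_
    rw [Matrix.smul_mul, Matrix.trace_smul, (mem_affineSet.mp hX).2 i, smul_eq_mul, mul_comm]
  rw [this]
  ring

/-- Strict dual feasibility makes the sublevel sets of the primal objective on the relaxed cone
`X ⪰ -t` bounded. -/
theorem exists_norm_le_of_strict_dual {y : Fin m → ℝ} {Z : Matrix (Fin n) (Fin n) ℝ}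
    (h : Z + ∑ i, y i • P.A i = P.C) (hZ : Z.PosDef) (a : ℝ) :
    ∃ R : ℝ, 0 ≤ R ∧ ∀ X ∈ P.affineSet, ∀ t : ℝ, 0 ≤ t → t ≤ a → (X + t • 1).PosSemidef →
      traceInner P.C X ≤ a → ‖X‖ ≤ R := by
  obtain ⟨c, hc, hdom⟩ := hZ.exists_sub_smul_one
  set o : ℝ := ‖(1 : Matrix (Fin n) (Fin n) ℝ)‖
  refine ⟨(|a| + |P.b ⬝ᵥ y| + |a| * |Z.trace|) / c + |a| * o, by positivity,
    fun X hX t ht hta hpsd hobj => ?_⟩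
  have hta' := hta.trans (le_abs_self a)
  have h1 := trace_mul_nonneg_of_posSemidef hdom hpsd
  rw [Matrix.sub_mul, Matrix.trace_sub, Matrix.smul_mul, Matrix.one_mul, Matrix.mul_add,
    Matrix.trace_add, trace_slack_mul h hX, Matrix.mul_smul, Matrix.mul_one, Matrix.trace_smul,
    Matrix.trace_smul, smul_eq_mul, smul_eq_mul] at h1
  have h2 : t * Z.trace ≤ |a| * |Z.trace| := by
    have := le_abs_self Z.trace
    calc t * Z.trace ≤ t * |Z.trace| := by gcongr
      _ ≤ _ := by gcongr
  have h3 : ‖X + t • 1‖ ≤ (|a| + |P.b ⬝ᵥ y| + |a| * |Z.trace|) / c := by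
    refine (norm_le_trace_of_posSemidef hpsd).trans ?_
    rw [le_div_iff₀ hc]
    linarith [le_abs_self a, neg_abs_le (P.b ⬝ᵥ y)]
  have h4 : ‖X‖ ≤ ‖X + t • 1‖ + ‖t • (1 : Matrix (Fin n) (Fin n) ℝ)‖ := by
    simpa using norm_sub_le (X + t • 1) (t • (1 : Matrix (Fin n) (Fin n) ℝ))
  rw [norm_smul, Real.norm_of_nonneg ht] at h4
  have h5 : t * o ≤ |a| * o := by gcongr
  linarith

theorem primalOptimal_nonempty (hS : P.Slater) : P.primalOptimal.Nonempty := by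
  obtain ⟨⟨X₀, hX₀, hX₀pd⟩, y, Z, hyZ, hZ⟩ := hS
  set a := |traceInner P.C X₀| with ha
  obtain ⟨R, -, hR⟩ := exists_norm_le_of_strict_dual hyZ hZ a
  set T : Set (Matrix (Fin n) (Fin n) ℝ) :=
    {X | X ∈ P.primalFeasible ∧ traceInner P.C X ≤ traceInner P.C X₀} with hT
  have hcont : ∀ A : Matrix (Fin n) (Fin n) ℝ, Continuous fun X => traceInner A X := by
    intro A
    unfold traceInner
    fun_prop
  have hclosed : IsClosed T := by
    have h1 : IsClosed P.affineSet := by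
      simp only [affineSet, Set.ofPred_and, Set.ofPred_forall]
      exact (isClosed_eq (by fun_prop) (by fun_prop)).inter
        (isClosed_iInter fun i => isClosed_eq (hcont _) continuous_const)
    exact (h1.inter isClosed_posSemidef).inter (isClosed_le (hcont _) continuous_const)
  have hcompact : IsCompact T := by
    refine IsCompact.of_isClosed_subset (isCompact_univ_pi fun _ : Fin n =>
      isCompact_univ_pi fun _ : Fin n => isCompact_Icc (a := -R) (b := R)) hclosed ?_
    intro X hX i _ j _
    refine abs_le.mp ((abs_apply_le_frobenius_norm X i j).trans
      (hR X hX.1.1 0 le_rfl (abs_nonneg _) ?_ (hX.2.trans (le_abs_self _))))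
    rw [zero_smul, add_zero]
    exact hX.1.2
  have hX₀T : X₀ ∈ T := ⟨⟨hX₀, hX₀pd.posSemidef⟩, le_rfl⟩
  obtain ⟨X, hX, hmin⟩ := hcompact.exists_isMinOn ⟨X₀, hX₀T⟩ (hcont P.C).continuousOn
  refine ⟨X, hX.1, fun Y hY => ?_⟩
  by_cases hYT : traceInner P.C Y ≤ traceInner P.C X₀
  · exact hmin ⟨hY, hYT⟩
  · exact hX.2.trans (not_le.mp hYT).le

/-- Strong duality with dual attainment, under strict primal feasibility. The theorem of the
alternative is applied to the set of matrices satisfying the constraints at the optimal value: a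
positive definite one forces the objective to be constant, and an exposing matrix is, up to scaling,
an optimal dual slack. -/
theorem exists_dualFeasible_value_eq {X₀ X : Matrix (Fin n) (Fin n) ℝ} (hX₀ : X₀ ∈ P.affineSet)
    (hX₀pd : X₀.PosDef) (hX : X ∈ P.primalOptimal) :
    ∃ p ∈ P.dualFeasible, P.b ⬝ᵥ p.1 = traceInner P.C X := by
  have hXmin : ∀ Y ∈ P.affineSet, Y.PosSemidef → traceInner P.C X ≤ traceInner P.C Y :=
    fun Y hY hY' => hX.2 ⟨hY, hY'⟩
  have hCi := traceInner_of_isHermitian P.C_symm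
  set V := P.affineDirection ⊓ LinearMap.ker (traceMulLeft P.C) with hV
  rcases slater_or_exists_exposing (P := 1) (V := V) (by simp) (by simp) hX.1.2
    (by simp [mem_compressedMatrices]) (fun D _ => by simp [mem_compressedMatrices])
    (fun D hD => hD.1.1) with ⟨D₀, hD₀, c, hc, hpsd⟩ | ⟨W, hW, -, hW0, hWX, hWV⟩
  -- Otherwise one could decrease the objective from a positive definite optimal solution.
  · have hconst : ∀ D ∈ P.affineDirection, (P.C * D).trace = 0 := by
      intro D hD
      by_contra hne
      set g := (P.C * D).trace with hg
      set s := c / (|g| * ‖D‖ + 1) with hs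
      have hs0 : 0 < s := by positivity
      have hD' : -(s * g) • D ∈ P.affineDirection := P.affineDirection.smul_mem _ hD
      have hle : ‖-(s * g) • D‖ ≤ c := by
        rw [norm_smul, norm_neg, Real.norm_eq_abs, abs_mul, abs_of_pos hs0, mul_assoc, hs,
          div_mul_eq_mul_div, div_le_iff₀ (by positivity)]
        gcongr
        linarith
      have h1 := hpsd.add (posSemidef_add_smul_one hD'.1 hle)
      have h2 := hXmin (X + D₀ + -(s * g) • D)
        (add_mem_affineSet (add_mem_affineSet hX.1.1 hD₀.1) hD') (by
          convert h1 using 1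
          module)
      have h3 : (P.C * D₀).trace = 0 := hD₀.2
      rw [hCi, hCi, Matrix.mul_add, Matrix.mul_add, Matrix.trace_add, Matrix.trace_add, h3,
        Matrix.mul_smul, Matrix.trace_smul, ← hg, smul_eq_mul] at h2
      have : 0 < s * g ^ 2 := by positivity
      nlinarith
    obtain ⟨y, hy⟩ := exists_eq_sum_smul_of_trace_eq_zero P.A_symm P.C_symm
      fun D hD hD' => hconst D ⟨hD, hD'⟩
    refine ⟨(y, 0), ⟨by simp [hy], .zero⟩, ?_⟩
    have h1 := trace_slack_mul (P := P) (y := y) (Z := 0) (by simp [hy]) hX.1.1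
    simp only [Matrix.zero_mul, Matrix.trace_zero] at h1
    simp only
    linarith
  · obtain ⟨β, hβ⟩ := exists_eq_sum_smul_of_trace_eq_zero (κ := Option (Fin m))
      (B := fun o => o.elim P.C P.A) (W := W) (Option.rec P.C_symm P.A_symm)
      hW.1 fun D hD hD' => hWV D ⟨⟨hD, fun i => hD' (some i)⟩, hD' none⟩
    rw [Fintype.sum_option] at hβ
    simp only [Option.elim_none, Option.elim_some] at hβ
    have hval : ∀ Y ∈ P.affineSet,
        (W * Y).trace = β none * traceInner P.C Y + P.b ⬝ᵥ fun i => β (some i) := by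
      intro Y hY
      rw [hβ, Matrix.add_mul, Matrix.trace_add, Matrix.smul_mul, Matrix.trace_smul, ← hCi,
        smul_eq_mul, Matrix.sum_mul, Matrix.trace_sum]
      congr 1
      refine Finset.sum_congr rfl fun i _ => ?_
      rw [Matrix.smul_mul, Matrix.trace_smul, (mem_affineSet.mp hY).2 i, smul_eq_mul, mul_comm]
    -- `⟨W, ·⟩` vanishes at the optimum and is positive at the strictly feasible point.
    have hα : 0 < β none := by
      obtain ⟨c, hc, hdom⟩ := hX₀pd.exists_sub_smul_one
      have h1 := trace_mul_nonneg_of_posSemidef hW hdom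
      rw [Matrix.mul_sub, Matrix.trace_sub, Matrix.mul_smul, Matrix.mul_one, Matrix.trace_smul,
        hval X₀ hX₀, smul_eq_mul] at h1
      have h2 : 0 < W.trace := lt_of_le_of_ne hW.trace_nonneg
        (Ne.symm fun h => hW0 (hW.trace_eq_zero_iff.mp h))
      have h3 := hXmin X₀ hX₀ hX₀pd.posSemidef
      have h4 := hval X hX.1.1
      rw [hWX] at h4
      have h5 : 0 < c * W.trace := by positivity
      by_contra! hneg
      nlinarith [mul_nonneg (neg_nonneg.mpr hneg) (sub_nonneg.mpr h3)]
    have hslack : (β none)⁻¹ • W + ∑ i, (-((β none)⁻¹ * β (some i))) • P.A i = P.C := by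
      have h1 : ∑ i, (-((β none)⁻¹ * β (some i))) • P.A i =
          -((β none)⁻¹ • ∑ i, β (some i) • P.A i) := by
        rw [Finset.smul_sum, ← Finset.sum_neg_distrib]
        exact Finset.sum_congr rfl fun i _ => by rw [neg_smul, mul_smul]
      rw [h1, hβ, smul_add, inv_smul_smul₀ hα.ne', add_neg_cancel_right]
    refine ⟨(fun i => -((β none)⁻¹ * β (some i)), (β none)⁻¹ • W),
      ⟨hslack, hW.smul (inv_nonneg.mpr hα.le)⟩, ?_⟩
    have h1 := trace_slack_mul hslack hX.1.1
    rw [Matrix.smul_mul, Matrix.trace_smul, hWX, smul_zero] at h1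
    simp only
    linarith

theorem weak_duality {p : (Fin m → ℝ) × Matrix (Fin n) (Fin n) ℝ} (hp : p ∈ P.dualFeasible)
    {X : Matrix (Fin n) (Fin n) ℝ} (hX : X ∈ P.primalFeasible) :
    P.b ⬝ᵥ p.1 ≤ traceInner P.C X := by
  have h1 := trace_mul_nonneg_of_posSemidef hp.2 hX.2
  rw [trace_slack_mul hp.1 hX.1] at h1
  linarith

theorem dualOptimal_nonempty {X₀ X : Matrix (Fin n) (Fin n) ℝ} (hX₀ : X₀ ∈ P.affineSet)
    (hX₀pd : X₀.PosDef) (hX : X ∈ P.primalOptimal) : P.dualOptimal.Nonempty := by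
  obtain ⟨p, hp, hval⟩ := exists_dualFeasible_value_eq hX₀ hX₀pd hX
  exact ⟨p, hp, fun q hq => (weak_duality hq hX.1).trans_eq hval.symm⟩

theorem dualOptimal_value_eq {X₀ X : Matrix (Fin n) (Fin n) ℝ} (hX₀ : X₀ ∈ P.affineSet)
    (hX₀pd : X₀.PosDef) (hX : X ∈ P.primalOptimal)
    {p : (Fin m → ℝ) × Matrix (Fin n) (Fin n) ℝ} (hp : p ∈ P.dualOptimal) :
    P.b ⬝ᵥ p.1 = traceInner P.C X := by
  obtain ⟨q, hq, hval⟩ := exists_dualFeasible_value_eq hX₀ hX₀pd hX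
  exact le_antisymm (weak_duality hp.1 hX.1) (hval ▸ hp.2 hq)

/-- Strict primal feasibility bounds the dual optimal slacks, so that `maxDualTrace` is a genuine
supremum. -/
theorem trace_le_maxDualTrace {X₀ X : Matrix (Fin n) (Fin n) ℝ} (hX₀ : X₀ ∈ P.affineSet)
    (hX₀pd : X₀.PosDef) (hX : X ∈ P.primalOptimal)
    {p : (Fin m → ℝ) × Matrix (Fin n) (Fin n) ℝ} (hp : p ∈ P.dualOptimal) :
    p.2.trace ≤ P.maxDualTrace := by
  obtain ⟨c, hc, hdom⟩ := hX₀pd.exists_sub_smul_one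
  refine le_csSup ⟨(traceInner P.C X₀ - traceInner P.C X) / c, ?_⟩ ⟨p, hp, rfl⟩
  rintro _ ⟨q, hq, rfl⟩
  have h1 := trace_mul_nonneg_of_posSemidef hq.1.2 hdom
  rw [Matrix.mul_sub, Matrix.trace_sub, trace_slack_mul hq.1.1 hX₀,
    dualOptimal_value_eq hX₀ hX₀pd hX hq, Matrix.mul_smul, Matrix.mul_one, Matrix.trace_smul,
    smul_eq_mul] at h1
  rw [le_div_iff₀ hc]
  simp only
  linarith

end SDPData

/-! ### Growth of the penalty function -/

namespace SDPData

variable {n m : ℕ} {P : SDPData n m}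

/-- The directions of the affine set that are orthogonal to the slack `Z`. If `Z` is dual optimal,
`X` is primal optimal and the duality gap is zero, the primal optimal set is the intersection of the
positive semidefinite cone with the translate of this space through `X`. -/
def optimalDirection (P : SDPData n m) (Z : Matrix (Fin n) (Fin n) ℝ) :
    Submodule ℝ (Matrix (Fin n) (Fin n) ℝ) :=
  P.affineDirection ⊓ LinearMap.ker (traceMulLeft Z)

theorem mem_primalOptimal_of_trace_eq_zero {p : (Fin m → ℝ) × Matrix (Fin n) (Fin n) ℝ}
    (hp : p ∈ P.dualFeasible) {X : Matrix (Fin n) (Fin n) ℝ} (hX : X ∈ P.primalFeasible)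
    (h : (p.2 * X).trace = 0) : X ∈ P.primalOptimal := by
  refine ⟨hX, fun Y hY => ?_⟩
  rw [trace_slack_mul hp.1 hX.1] at h
  have := weak_duality hp hY
  simp only [Set.mem_ofPred_eq]
  linarith

theorem penalized_of_posSemidef (ρ : ℝ) {X : Matrix (Fin n) (Fin n) ℝ} (hX : X.PosSemidef) :
    P.penalized ρ X = traceInner P.C X := by
  rw [penalized, max_lambdaMax_neg_eq_zero hX, mul_zero, add_zero]

/-- Transfer of an error bound from the optimal face to the penalty function. By exactness of the
penalty, the gap `δ = F(X) - F⋆` bounds both the violation `λ_max(-X)` of the cone constraint and,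
up to a factor, the violation `|⟨Z, X⟩|` of complementary slackness. -/
theorem exists_penalized_growth (hS : P.Slater) {ρ : ℝ} {X₁ : Matrix (Fin n) (Fin n) ℝ}
    (hX₁ : X₁ ∈ P.primalOptimal) {p : (Fin m → ℝ) × Matrix (Fin n) (Fin n) ℝ}
    (hp : p ∈ P.dualFeasible) (hval : P.b ⬝ᵥ p.1 = traceInner P.C X₁)
    (hρ : p.2.trace + 1 ≤ ρ) {k : ℕ} (hk : 1 ≤ k)
    (hbound : HolderErrorBound X₁ (P.optimalDirection p.2) k) {ε : ℝ} (hε : 0 < ε) :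
    ∃ μ : ℝ, 0 < μ ∧ ∀ Xs ∈ P.primalOptimal, ∀ X ∈ P.affineSet,
      P.penalized ρ X ≤ P.penalized ρ Xs + ε →
      μ * frobDist X P.primalOptimal ^ k ≤ P.penalized ρ X - P.penalized ρ Xs := by
  obtain ⟨y, Z₀, hyZ, hZ₀⟩ := hS.2
  set v := traceInner P.C X₁ with hv
  set T := 1 + p.2.trace with hT
  have hZtr : 0 ≤ p.2.trace := hp.2.trace_nonneg
  obtain ⟨B, hB0, hB⟩ := exists_norm_le_of_strict_dual hyZ hZ₀ (|v| + ε)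
  obtain ⟨K₀, hK₀, hproj⟩ := P.affineDirection.exists_norm_sub_ker_le (traceMulLeft p.2)
  set L := K₀ * T with hL
  have hL0 : 0 ≤ L := by positivity
  obtain ⟨K, hK, hrec⟩ := hbound (B + ‖X₁‖ + (1 + L) * ε)
  set M := 2 ^ (k - 1) * (L ^ k * ε ^ (k - 1) + K * (1 + L)) with hM
  have hM0 : 0 < M := by positivity
  have hZX₁ : (p.2 * X₁).trace = 0 := by
    rw [trace_slack_mul hp.1 hX₁.1.1, hval, sub_self]
  refine ⟨M⁻¹, inv_pos.mpr hM0, fun Xs hXs X hX hle => ?_⟩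
  have hvs : P.penalized ρ Xs = v := by
    rw [penalized_of_posSemidef ρ hXs.1.2]
    exact le_antisymm (hXs.2 hX₁.1) (hX₁.2 hXs.1)
  rw [hvs] at hle ⊢
  set t := max (lambdaMax (-X)) 0 with ht
  have ht0 : 0 ≤ t := le_max_right _ _
  have hpsd : (X + t • 1).PosSemidef := posSemidef_add_lambdaMax hX.1
  set δ := P.penalized ρ X - v with hδ
  have hZX : (p.2 * X).trace = traceInner P.C X - v := by rw [trace_slack_mul hp.1 hX, hval]
  have hδ' : δ = (p.2 * X).trace + ρ * t := by
    rw [hδ, hZX, penalized]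
    ring
  have hlow : -(t * p.2.trace) ≤ (p.2 * X).trace := by
    have h1 := trace_mul_nonneg_of_posSemidef hp.2 hpsd
    rw [Matrix.mul_add, Matrix.trace_add, Matrix.mul_smul, Matrix.mul_one, Matrix.trace_smul,
      smul_eq_mul] at h1
    linarith
  have htδ : t ≤ δ := by nlinarith
  have hδ0 : 0 ≤ δ := ht0.trans htδ
  have hδε : δ ≤ ε := by linarith
  have hZabs : |(p.2 * X).trace| ≤ T * δ := by
    refine abs_le.mpr ⟨?_, ?_⟩
    · nlinarith
    · nlinarith
  set D := X - X₁ with hD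
  have hDmem : D ∈ P.affineDirection := sub_mem_affineDirection hX hX₁.1.1
  obtain ⟨D', hD', hZD', hDD'⟩ := hproj D hDmem
  rw [traceMulLeft_apply, hD, Matrix.mul_sub, Matrix.trace_sub, hZX₁, sub_zero, ← hD] at hDD'
  have hDD'L : ‖D - D'‖ ≤ L * δ := by
    calc ‖D - D'‖ ≤ K₀ * (T * δ) := hDD'.trans (by gcongr)
      _ = L * δ := by rw [hL]; ring
  have hXB : ‖X‖ ≤ B := by
    refine hB X hX t ht0 ?_ hpsd ?_
    · linarith [abs_nonneg v]
    · nlinarith [le_abs_self v]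
  have hpsd' : (X₁ + D' + ((1 + L) * δ) • 1).PosSemidef := by
    have h1 : (D' - D + (L * δ) • 1).PosSemidef :=
      posSemidef_add_smul_one (hD'.1.sub hDmem.1) ((norm_sub_rev D' D).trans_le hDD'L)
    have h2 : ((δ - t) • (1 : Matrix (Fin n) (Fin n) ℝ)).PosSemidef :=
      Matrix.PosSemidef.one.smul (sub_nonneg.mpr htδ)
    convert (hpsd.add h1).add h2 using 1
    rw [hD]
    module
  have hLδ : L * δ ≤ L * ε := by gcongr
  obtain ⟨E, hE, hEpsd, hDE⟩ := hrec ((1 + L) * δ) (by positivity)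
    (by nlinarith [norm_nonneg X₁]) D' ⟨hD', hZD'⟩ (by
      have h1 : ‖D'‖ ≤ ‖D‖ + ‖D - D'‖ := by simpa using norm_sub_le D (D - D')
      have h2 : ‖D‖ ≤ ‖X‖ + ‖X₁‖ := norm_sub_le X X₁
      linarith) hpsd'
  have hEopt : X₁ + E ∈ P.primalOptimal := by
    refine mem_primalOptimal_of_trace_eq_zero hp ⟨add_mem_affineSet hX₁.1.1 hE.1, hEpsd⟩ ?_
    rw [Matrix.mul_add, Matrix.trace_add, hZX₁, zero_add]
    exact hE.2
  have hdist : frobDist X P.primalOptimal ≤ L * δ + ‖D' - E‖ := by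
    refine (frobDist_le hEopt).trans ?_
    have h1 : X₁ + E - X = -((D - D') + (D' - E)) := by
      rw [hD]
      abel
    rw [h1, norm_neg]
    exact (norm_add_le _ _).trans (by gcongr)
  rw [inv_mul_le_iff₀ hM0]
  have hpow : (L * δ) ^ k ≤ L ^ k * ε ^ (k - 1) * δ := by
    calc (L * δ) ^ k = L ^ k * (δ ^ (k - 1) * δ) := by
          rw [mul_pow, ← pow_succ, Nat.sub_add_cancel hk]
      _ ≤ L ^ k * (ε ^ (k - 1) * δ) := by gcongr
      _ = _ := by ring
  calc frobDist X P.primalOptimal ^ k ≤ (L * δ + ‖D' - E‖) ^ k := by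
        gcongr
        exact frobDist_nonneg _ _
    _ ≤ 2 ^ (k - 1) * ((L * δ) ^ k + ‖D' - E‖ ^ k) :=
      add_pow_le (by positivity) (norm_nonneg _) k
    _ ≤ 2 ^ (k - 1) * (L ^ k * ε ^ (k - 1) * δ + K * ((1 + L) * δ)) := by gcongr
    _ = M * δ := by rw [hM]; ring

end SDPData

/-! ### Strict complementarity -/

section StrictComplementarity

variable {ι : Type*} [Fintype ι] [DecidableEq ι]

/-- Positive semidefinite matrices with `X Z = 0` whose ranks add up to the full dimension have
complementary ranges, so their sum is positive definite. Compressing it to the kernel of `Z` shows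
that `X` is a relative interior point of the face of `P`. -/
theorem exists_sub_smul_kernel_projection {X Z P : Matrix ι ι ℝ} (hX : X.PosSemidef)
    (hZ : Z.PosSemidef) (hXZ : X * Z = 0) (hrank : X.rank + Z.rank = Fintype.card ι)
    (hP : Pᵀ = P) (hPP : P * P = P) (hZP : Z * P = 0) (hXP : X ∈ compressedMatrices P) :
    ∃ c : ℝ, 0 < c ∧ (X - c • P).PosSemidef := by
  have htr : ∀ {M : Matrix ι ι ℝ}, M.PosSemidef → Mᵀ = M := fun hM => by
    rw [← Matrix.conjTranspose_eq_transpose_of_trivial]; exact hM.1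
  have hZX : Z * X = 0 := by
    have := congrArg Matrix.transpose hXZ
    rwa [Matrix.transpose_mul, htr hX, htr hZ, Matrix.transpose_zero] at this
  have hker : LinearMap.range Z.mulVecLin = LinearMap.ker X.mulVecLin := by
    refine Submodule.eq_of_le_of_finrank_le ?_ ?_
    · rintro _ ⟨v, rfl⟩
      simp [Matrix.mulVec_mulVec, hXZ]
    · have h1 := LinearMap.finrank_range_add_finrank_ker X.mulVecLin
      rw [Module.finrank_fintype_fun_eq_card] at h1
      simp only [Matrix.rank] at hrank
      omega
  -- A vector killed by both matrices lies in the range of `Z`, hence is orthogonal to itself.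
  have hinj : ∀ v : ι → ℝ, X *ᵥ v = 0 → Z *ᵥ v = 0 → v = 0 := by
    intro v hXv hZv
    obtain ⟨w, rfl⟩ : v ∈ LinearMap.range Z.mulVecLin := hker ▸ hXv
    rw [Matrix.mulVecLin_apply] at hZv ⊢
    refine dotProduct_self_eq_zero.mp ?_
    rw [Matrix.dotProduct_mulVec, ← Matrix.mulVec_transpose, htr hZ, hZv, zero_dotProduct]
  obtain ⟨Q, c, -, -, hMQ, hc, hdom⟩ := exists_kernel_projection (hX.add hZ)
  have hZQ : Z * Q = 0 := by
    have h1 : Z * (Z * Q) = 0 := by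
      have := congrArg (Z * ·) hMQ
      simpa [Matrix.add_mul, Matrix.mul_add, ← Matrix.mul_assoc, hZX] using this
    have h2 : (Z * Q)ᴴ * (Z * Q) = 0 := by
      rw [Matrix.conjTranspose_mul, hZ.1, Matrix.mul_assoc, h1, Matrix.mul_zero]
    exact Matrix.conjTranspose_mul_self_eq_zero.mp h2
  have hXQ : X * Q = 0 := by rwa [Matrix.add_mul, hZQ, add_zero] at hMQ
  have hQ0 : Q = 0 := by
    refine Matrix.ext_of_mulVec_single fun i => ?_
    rw [Matrix.zero_mulVec]
    exact hinj _ (by rw [Matrix.mulVec_mulVec, hXQ, Matrix.zero_mulVec])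
      (by rw [Matrix.mulVec_mulVec, hZQ, Matrix.zero_mulVec])
  refine ⟨c, hc, ?_⟩
  have h1 := posSemidef_conj hdom hP
  rwa [hQ0, sub_zero, Matrix.mul_sub, Matrix.sub_mul, Matrix.mul_add, Matrix.add_mul,
    mem_compressedMatrices.mp hXP, Matrix.mul_assoc P Z, hZP, Matrix.mul_zero, add_zero,
    Matrix.mul_smul, Matrix.mul_one, Matrix.smul_mul, hPP] at h1

end StrictComplementarity

end FrobeniusNorm

theorem mainTheorem7 {n m : ℕ} (P : SDPData n m)
    (hA : LinearIndependent ℝ P.A) (hS : P.Slater)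
    (ρ : ℝ) (hρ : 2 * P.maxDualTrace + 1 < ρ) :
    P.primalOptimal.Nonempty ∧
    ∀ ε : ℝ, 0 < ε →
      (∃ ζ : ℝ, 1 ≤ ζ ∧ ∃ μ : ℝ, 0 < μ ∧
        ∀ Xs ∈ P.primalOptimal, ∀ X ∈ P.affineSet,
          P.penalized ρ X ≤ P.penalized ρ Xs + ε →
          μ * frobDist X P.primalOptimal ^ ζ ≤ P.penalized ρ X - P.penalized ρ Xs) ∧
      (P.StrictComplementarity →
        ∃ μ : ℝ, 0 < μ ∧
          ∀ Xs ∈ P.primalOptimal, ∀ X ∈ P.affineSet,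
            P.penalized ρ X ≤ P.penalized ρ Xs + ε →
            μ * frobDist X P.primalOptimal ^ 2 ≤ P.penalized ρ X - P.penalized ρ Xs) := by
  obtain ⟨X₀, hX₀, hX₀pd⟩ := hS.1
  have hne := SDPData.primalOptimal_nonempty hS
  have hρ' : ∀ X ∈ P.primalOptimal, ∀ p ∈ P.dualOptimal, p.2.trace + 1 ≤ ρ := by
    intro X hX p hp
    have h1 := SDPData.trace_le_maxDualTrace hX₀ hX₀pd hX hp
    have h2 := hp.1.2.trace_nonneg
    linarith
  refine ⟨hne, fun ε hε => ⟨?_, ?_⟩⟩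
  · obtain ⟨X, hX⟩ := hne
    obtain ⟨p, hp⟩ := SDPData.dualOptimal_nonempty hX₀ hX₀pd hX
    obtain ⟨k, hk, hbound⟩ := exists_holderErrorBound (V := P.optimalDirection p.2) hX.1.2
      fun D hD => hD.1.1
    obtain ⟨μ, hμ, h⟩ := SDPData.exists_penalized_growth hS hX hp.1
      (SDPData.dualOptimal_value_eq hX₀ hX₀pd hX hp) (hρ' X hX p hp) hk hbound hε
    exact ⟨k, by exact_mod_cast hk, μ, hμ, by simpa only [Real.rpow_natCast] using h⟩
  · rintro ⟨X, hX, p, hp, hrank⟩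
    have hval := SDPData.dualOptimal_value_eq hX₀ hX₀pd hX hp
    have hZX : (p.2 * X).trace = 0 := by
      rw [SDPData.trace_slack_mul hp.1.1 hX.1.1, hval, sub_self]
    obtain ⟨Q, c, hQ, hQQ, hZQ, hc, hdom⟩ := exists_kernel_projection hp.1.2
    have hXQ := mem_compressedMatrices_of_trace_eq_zero hQ hQQ hc hdom hX.1.2 hZX
    have hQZ : Q * p.2 = 0 := by
      have := congrArg Matrix.transpose hZQ
      rwa [Matrix.transpose_mul, hQ, ← Matrix.conjTranspose_eq_transpose_of_trivial p.2,
        hp.1.2.1, Matrix.transpose_zero] at this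
    have hXZ : X * p.2 = 0 := by
      rw [← mem_compressedMatrices.mp hXQ, Matrix.mul_assoc, hQZ, Matrix.mul_zero]
    obtain ⟨c', hc', hslater⟩ := exists_sub_smul_kernel_projection hX.1.2 hp.1.2 hXZ
      (by simpa using hrank) hQ hQQ hZQ hXQ
    have hbound : HolderErrorBound X (P.optimalDirection p.2) (2 * 1) :=
      HolderErrorBound.of_face le_rfl hQ hQQ hc hdom hX.1.2 hZX (fun D hD => hD.2)
        (fun D hD => hD.1.1) (holderErrorBound_one_of_slater hQ hQQ hXQ inf_le_right
          (Submodule.zero_mem _) hc' (by rwa [add_zero]))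
    exact SDPData.exists_penalized_growth hS hX hp.1 hval (hρ' X hX p hp) (by norm_num)
      hbound hε
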